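/- Let $\mathbb F_2$ be the free group on two generators with the word metric $d$ of its standard generating set, and view its Cayley graph as a tree rooted at $1$. Fix any labelling of the edges from each vertex to its children, by $a,b,c,d$ at the root and by $a,b,c$ at every other vertex, and identify each vertex with the word read along the path from the root to it. For a vertex $v$ and $k\ge 1$ let $T_k(v)$ be the set of vertices $vu$ with $u$ a word of length at most $k$. For $v,w$ both equal to $1$ or both different from $1$ let $I_k(v,w):T_k(v)\to T_k(w)$, $vu\mapsto wu$. For $v,w\neq 1$ let $X_k(v,w):T_k(v)\to\mathbb F_2$ be the map with $$vb^i\mapsto wb^i\ (0\le i\le k),\qquad vb^iap\mapsto wb^iap\ (0\le i\le k-1),$$ $$vb^icp\mapsto wb^{i-1}cp\ (1\le i\le k-1),\qquad vcp\mapsto wb^{k-1}cp,$$ where $p$ is any word on $\{a,b,c\}$ for which the word read from $v$ has length at most $k$. Let $\mathcal X=\bigcup_{n\ge 0}[8^{2n},8^{2n+1})\subset\mathbb N$, and let $C\ge 4$ be an integer. The Christmas tree map $f:\mathbb F_2\to\mathbb F_2$ is defined by $f(1)=1$ and, iteratively for the vertices $v$ with $C\mid d(1,v)$ in order of their distance to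 $1$, $$f|_{T_C(v)}=\begin{cases}X_C(v,f(v)) & \text{if } d(1,v)/C\in\mathcal X,\\ I_C(v,f(v)) & \text{otherwise.}\end{cases}$$ Then $f$ is a bijection and a $(C,0)$-quasi-isometry, that is, $\frac1C d(g,h)\le d(f(g),f(h))\le C\,d(g,h)$ for all $g,h\in\mathbb F_2$. Moreover, let $(w_n)_n$ be the push-forward by $f$ of the simple random walk on $\mathbb F_2$ started at $1$, that is, the Markov chain on $\mathbb F_2$ started at $f(1)=1$ whose transition probability from $g$ to $h$ is that of the simple random walk from $f^{-1}(g)$ to $f^{-1}(h)$. Then $(w_n)_n$ has no well-defined drift: $\frac1n\,\mathbb E[d(1,w_n)]$ does not converge as $n\to\infty$. -/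

import Mathlib

open scoped ENNReal
open Filter Topology

namespace ChristmasTree

/-! ### The free group `F₂` with the metric of its standard Cayley graph -/

/-- The free group of rank two. -/
abbrev F2 : Type := FreeGroup (Fin 2)

/-- The word metric of `F₂` for the standard generating set, i.e. the graph distance of the
Cayley graph. -/
def wordDist (g h : F2) : ℕ := (g⁻¹ * h).norm

/-- `f` is a `(K, A)`-quasi-isometry of `F₂`: a quasi-isometric embedding that is coarsely onto. -/
def IsQuasiIsometry (K A : ℝ) (f : F2 → F2) : Prop :=
  (∀ g h : F2, (wordDist g h : ℝ) / K - A ≤ wordDist (f g) (f h) ∧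
    (wordDist (f g) (f h) : ℝ) ≤ K * wordDist g h + A) ∧
  ∀ y : F2, ∃ g : F2, (wordDist (f g) y : ℝ) ≤ A

/-! ### Markov chains, push-forwards and drift -/

/-- The law of the position after `n` steps of the Markov chain with transition probabilities
`P x y` (from `x` to `y`) started at `p`. -/
noncomputable def stepLaw {α : Type} (P : α → PMF α) : ℕ → α → PMF α
  | 0, p => PMF.pure p
  | n + 1, p => (stepLaw P n p).bind P

/-- The push-forward of a Markov chain by a bijection `f`. As `f` is a bijection, the transition
probability from `g` to `h` is `P (f⁻¹ g) (f⁻¹ h)`, see `pushforward_apply`. -/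
noncomputable def pushforward {α β : Type} (P : α → PMF α) (f : α ≃ β) : β → PMF β :=
  fun g => (P (f.symm g)).map f

theorem pushforward_apply {α β : Type} (P : α → PMF α) (f : α ≃ β) (g h : β) :
    pushforward P f g h = P (f.symm g) (f.symm h) := by
  classical
  unfold pushforward
  rw [PMF.map_apply, tsum_eq_single (f.symm h)]
  · simp
  · intro b hb
    rw [if_neg]
    rintro rfl
    simp at hb

/-- The simple random walk on `F₂`: from `g`, move to `g s` with `s` uniformly distributed among
the four elements `a`, `a⁻¹`, `b`, `b⁻¹`. -/
noncomputable def simpleRandomWalk : F2 → PMF F2 :=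
  fun g => (PMF.uniformOfFintype (Fin 2 × Bool)).map fun s => g * FreeGroup.mk [s]

/-- The expected distance, `𝔼[d(p, w_n)]`, at time `n` from the starting point `p`. -/
noncomputable def expectedDist (P : F2 → PMF F2) (p : F2) (n : ℕ) : ℝ≥0∞ :=
  ∑' h : F2, stepLaw P n p h * (wordDist p h : ℝ≥0∞)

/-- The chain with transition probabilities `P` started at `p` has drift `L`, that is
`𝔼[d(p, w_n)] / n` tends to `L`. -/
def HasDrift (P : F2 → PMF F2) (p : F2) (L : ℝ≥0∞) : Prop :=
  Tendsto (fun n : ℕ => expectedDist P p n / (n : ℝ≥0∞)) atTop (𝓝 L)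

/-! ### `F₂` as a labelled rooted tree -/

/-- Labels of the edges from a vertex other than the root to its three children. -/
inductive Letter : Type
  | a | b | c

/-- The vertices of the rooted tree `T` in which the root has four children (its edges are
labelled by `Fin 4`) and any other vertex has three children (edges labelled by `Letter`). A vertex
is the word read along the path from the root: `none` is the root, and `some (x, u)` is the
vertex reached by the edge `x` from the root followed by the edges `u`. -/
abbrev Vertex : Type := Option (Fin 4 × List Letter)

/-- A labelling of the edges of the Cayley graph of `F₂`, seen as a tree rooted at `1`, through
which vertices are identified with words. -/
structure Labelling where
  /-- The vertex of `F₂` reached from `1` by a word. -/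
  toEquiv : Vertex ≃ F2
  map_root : toEquiv none = 1
  adj_root : ∀ x : Fin 4, wordDist (toEquiv none) (toEquiv (some (x, []))) = 1
  adj_child : ∀ (x : Fin 4) (u : List Letter) (y : Letter),
    wordDist (toEquiv (some (x, u))) (toEquiv (some (x, u ++ [y]))) = 1

/-- The three edge letters that may follow the letter `s` in a reduced word. -/
def turn (s : Fin 2 × Bool) : Letter → Fin 2 × Bool
  | .a => (s.1 + 1, true)
  | .b => s
  | .c => (s.1 + 1, false)

/-- The reduced word with first letter `s` that takes the turns `u`. -/
def turnWord : Fin 2 × Bool → List Letter → List (Fin 2 × Bool)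
  | s, [] => [s]
  | s, y :: u => s :: turnWord (turn s y) u

theorem turnWord_eq_cons (s : Fin 2 × Bool) (u : List Letter) :
    ∃ l, turnWord s u = s :: l := by
  cases u <;> exact ⟨_, rfl⟩

theorem turnWord_append (s : Fin 2 × Bool) (u : List Letter) (y : Letter) :
    ∃ t, turnWord s (u ++ [y]) = turnWord s u ++ [t] := by
  induction u generalizing s with
  | nil => exact ⟨_, rfl⟩
  | cons z u ih =>
    obtain ⟨t, ht⟩ := ih (turn s z)
    exact ⟨t, by simp [turnWord, ht]⟩

theorem fin_two_succ_ne (i : Fin 2) : ¬ i = i + 1 := by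
  revert i; decide

theorem isReduced_turnWord (s : Fin 2 × Bool) (u : List Letter) :
    FreeGroup.IsReduced (turnWord s u) := by
  induction u generalizing s with
  | nil => exact FreeGroup.IsReduced.singleton
  | cons y u ih =>
    obtain ⟨l, hl⟩ := turnWord_eq_cons (turn s y) u
    have h := ih (turn s y)
    simp only [turnWord]
    rw [hl] at h ⊢
    refine FreeGroup.isReduced_cons_cons.2 ⟨?_, h⟩
    cases y <;> simp [turn]

theorem turn_injective (s : Fin 2 × Bool) : Function.Injective (turn s) := by
  have := fin_two_succ_ne s.1
  intro y z h
  cases y <;> cases z <;> simp_all [turn, Prod.ext_iff]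

theorem turn_surjective (s t : Fin 2 × Bool) (h : s.1 = t.1 → s.2 = t.2) :
    ∃ y, turn s y = t := by
  obtain ⟨i, e⟩ := s
  obtain ⟨j, e'⟩ := t
  by_cases hij : i = j
  · exact ⟨.b, Prod.ext hij (h hij)⟩
  · have hj : i + 1 = j := by
      revert hij; clear h; revert i j; decide
    cases e'
    · exact ⟨.c, Prod.ext hj rfl⟩
    · exact ⟨.a, Prod.ext hj rfl⟩

theorem turnWord_injective (s t : Fin 2 × Bool) (u v : List Letter)
    (h : turnWord s u = turnWord t v) : s = t ∧ u = v := by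
  induction u generalizing s t v with
  | nil =>
    cases v with
    | nil => simpa [turnWord] using h
    | cons z v =>
      obtain ⟨l, hl⟩ := turnWord_eq_cons (turn t z) v
      simp [turnWord, hl] at h
  | cons y u ih =>
    cases v with
    | nil =>
      obtain ⟨l, hl⟩ := turnWord_eq_cons (turn s y) u
      simp [turnWord, hl] at h
    | cons z v =>
      simp only [turnWord, List.cons.injEq] at h
      obtain ⟨rfl, h⟩ := h
      obtain ⟨h1, rfl⟩ := ih _ _ _ h
      exact ⟨rfl, by rw [turn_injective s h1]⟩

theorem turnWord_surjective (s : Fin 2 × Bool) (l : List (Fin 2 × Bool))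
    (h : FreeGroup.IsReduced (s :: l)) : ∃ u, turnWord s u = s :: l := by
  induction l generalizing s with
  | nil => exact ⟨[], rfl⟩
  | cons t l ih =>
    obtain ⟨h1, h2⟩ := FreeGroup.isReduced_cons_cons.1 h
    obtain ⟨u, hu⟩ := ih t h2
    obtain ⟨y, rfl⟩ := turn_surjective s t h1
    exact ⟨y :: u, by simp [turnWord, hu]⟩

theorem wordDist_mk_append (l : List (Fin 2 × Bool)) (t : Fin 2 × Bool) :
    wordDist (FreeGroup.mk l) (FreeGroup.mk (l ++ [t])) = 1 := by
  rw [wordDist, ← FreeGroup.mul_mk, inv_mul_cancel_left]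
  simp [FreeGroup.norm, FreeGroup.toWord_mk,
    (FreeGroup.IsReduced.singleton (a := t)).reduce_eq]

/-- The four letters, as labels of the edges at the root. -/
noncomputable def rootLetter : Fin 4 ≃ Fin 2 × Bool :=
  Fintype.equivOfCardEq (by simp)

/-- The reduced word of a vertex. -/
noncomputable def vertexWord : Vertex → List (Fin 2 × Bool)
  | none => []
  | some (x, u) => turnWord (rootLetter x) u

theorem isReduced_vertexWord (w : Vertex) : FreeGroup.IsReduced (vertexWord w) := by
  rcases w with _ | ⟨x, u⟩
  · exact FreeGroup.IsReduced.nil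
  · exact isReduced_turnWord _ _

theorem bijective_mk_vertexWord :
    Function.Bijective fun w : Vertex => (FreeGroup.mk (vertexWord w) : F2) := by
  constructor
  · intro w w' h
    have h' : vertexWord w = vertexWord w' := by
      rw [← (isReduced_vertexWord w).reduce_eq, ← (isReduced_vertexWord w').reduce_eq]
      exact FreeGroup.reduce.sound h
    rcases w with _ | ⟨x, u⟩ <;> rcases w' with _ | ⟨x', u'⟩
    · rfl
    · obtain ⟨l, hl⟩ := turnWord_eq_cons (rootLetter x') u'
      simp [vertexWord, hl] at h'
    · obtain ⟨l, hl⟩ := turnWord_eq_cons (rootLetter x) u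
      simp [vertexWord, hl] at h'
    · obtain ⟨h1, rfl⟩ := turnWord_injective _ _ _ _ h'
      rw [rootLetter.injective h1]
  · intro g
    have hg : FreeGroup.IsReduced g.toWord := FreeGroup.isReduced_toWord
    have hm : FreeGroup.mk g.toWord = g := FreeGroup.mk_toWord
    cases hw : g.toWord with
    | nil => exact ⟨none, by rw [← hm, hw]; rfl⟩
    | cons s l =>
      rw [hw] at hg hm
      obtain ⟨u, hu⟩ := turnWord_surjective s l hg
      exact ⟨some (rootLetter.symm s, u), by simp [vertexWord, hu, hm]⟩

/-- Labellings exist. -/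
theorem nonempty_labelling : Nonempty Labelling :=
  ⟨{ toEquiv := Equiv.ofBijective _ bijective_mk_vertexWord
     map_root := rfl
     adj_root := fun x => wordDist_mk_append [] (rootLetter x)
     adj_child := fun x u y => by
       obtain ⟨t, ht⟩ := turnWord_append (rootLetter x) u y
       simp only [Equiv.ofBijective_apply, vertexWord, ht]
       exact wordDist_mk_append _ _ }⟩

/-! ### The Christmas tree map -/

/-- `bⁱ c p ↦ bⁱ⁻¹ c p` for `i ≥ 1`; all other words are fixed. -/
def dropB : List Letter → List Letter
  | .b :: .c :: p => .c :: p
  | .b :: u => .b :: dropB u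
  | u => u

/-- The map `X_k(v, w)` on the words `u` of length at most `k` read from `v`: it sends `v u` to
`w (xWord k u)`. So `c p ↦ bᵏ⁻¹ c p`, `bⁱ c p ↦ bⁱ⁻¹ c p` for `i ≥ 1`, and `bⁱ` and `bⁱ a p` are
fixed. -/
def xWord (k : ℕ) : List Letter → List Letter
  | .c :: p => List.replicate (k - 1) .b ++ .c :: p
  | u => dropB u

/-- The set `⋃ₙ [8²ⁿ, 8²ⁿ⁺¹)` of natural numbers. -/
def bands : Set ℕ := {q | ∃ n : ℕ, 8 ^ (2 * n) ≤ q ∧ q < 8 ^ (2 * n + 1)}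

open Classical in
/-- The map used on the subtrees `T_C(v)` with `v` at depth `q * C`, on words read from `v`:
`X_C` if `q ∈ bands`, and the identity otherwise. -/
noncomputable def blockWord (C q : ℕ) (u : List Letter) : List Letter :=
  if q ∈ bands then xWord C u else u

/-- Given a vertex `v` at depth `q * C`, the word read from `f v` to `f (v u)`, for a word `u` of
any length: cut `u` into blocks of length `C` and transform each one. -/
noncomputable def belowWord (C q : ℕ) (u : List Letter) : List Letter :=
  if C = 0 ∨ u.length ≤ C then blockWord C q u
  else blockWord C q (u.take C) ++ belowWord C (q + 1) (u.drop C)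
termination_by u.length
decreasing_by
  simp only [List.length_drop]
  omega

/-- The Christmas tree map on words: the identity down to depth `C`, and transformed in blocks of
length `C` from there on. -/
noncomputable def onVertex (C : ℕ) : Vertex → Vertex
  | none => none
  | some (x, u) => some (x, u.take (C - 1) ++ belowWord C 1 (u.drop (C - 1)))

/-- The Christmas tree map `f : F₂ → F₂` for the constant `C` and a labelling. -/
noncomputable def christmasTree (Λ : Labelling) (C : ℕ) (g : F2) : F2 :=
  Λ.toEquiv (onVertex C (Λ.toEquiv.symm g))

end ChristmasTree

open ChristmasTree

/-!
The map `f` acts on words block by block. In a block inside the bands, the words `c p` become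
longer by `C - 1` letters and the words `bⁱ c p` with `1 ≤ i < C` become shorter by one letter; the
operation on words of any length (`extWord`) has the explicit inverse `raiseB`, so that `belowWord`
has the inverse `unbelowWord`, obtained by undoing the first block and recursing on the rest. Both
`belowWord` and `unbelowWord` move the endpoints of an edge to distance at most `C`
(`near_belowWord`, `near_unbelowWord`). As the edges of the Cayley graph are exactly the edges of the tree
(`Labelling.exists_equiv_neighbour`), `f` and its inverse are `C`-Lipschitz.

For the drift, averages over the spheres around the root intertwine the Markov operator of the
simple random walk with that of its distance from the root (`sphereAvg_vertexOp`). Hence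
`𝔼[d(1, w_n)]` is the expectation of `meanDepth C |Z_n|`, where `Z_n` is the simple random walk and
`meanDepth C m` is the average of `d(1, f g)` over the sphere of radius `m`. The second moment
of `|Z_n| - n / 2` is at most `3 * n / 4` (`abs_iterate_radialOp_sub_le`) and `meanDepth C` is
`C`-Lipschitz, so `𝔼[d(1, w_n)]` differs from `meanDepth C (n / 2)` by `O(√n)`.

A random block in the bands lengthens by the mean amount `meanX C - C`, which is positive
(`lt_meanX`), and a block outside the bands keeps its length. So `meanDepth C (q * C)` is `q * C`
plus `meanX C - C` times the number of elements of the bands below `q` (`meanDepth_mul_eq`). The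
proportion of these is at least `7 / 8` for `q = 8 ^ (2 * n + 1)` and at most `1 / 8` for
`q = 8 ^ (2 * n + 2)`, so `𝔼[d(1, w_n)] / n` oscillates.
-/

namespace ChristmasTree

/-! ### Words: the inverse of the Christmas tree map -/

theorem word_cases (u : List Letter) :
    (∃ i, u = List.replicate i .b) ∨ (∃ i p, u = List.replicate i .b ++ .a :: p) ∨
      ∃ i p, u = List.replicate i .b ++ .c :: p := by
  induction u with
  | nil => exact .inl ⟨0, rfl⟩
  | cons y u ih =>
    cases y with
    | a => exact .inr (.inl ⟨0, u, rfl⟩)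
    | c => exact .inr (.inr ⟨0, u, rfl⟩)
    | b =>
      rcases ih with ⟨i, rfl⟩ | ⟨i, p, rfl⟩ | ⟨i, p, rfl⟩
      · exact .inl ⟨i + 1, rfl⟩
      · exact .inr (.inl ⟨i + 1, p, rfl⟩)
      · exact .inr (.inr ⟨i + 1, p, rfl⟩)

theorem dropB_replicate (i : ℕ) : dropB (List.replicate i .b) = List.replicate i .b := by
  induction i with
  | zero => rfl
  | succ i ih =>
    cases i with
    | zero => rfl
    | succ i =>
      simp only [List.replicate_succ, dropB] at ih ⊢
      rw [ih]

theorem dropB_replicate_a (i : ℕ) (p : List Letter) :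
    dropB (List.replicate i .b ++ .a :: p) = List.replicate i .b ++ .a :: p := by
  induction i with
  | zero => rfl
  | succ i ih =>
    cases i with
    | zero => rfl
    | succ i =>
      simp only [List.replicate_succ, List.cons_append, dropB] at ih ⊢
      rw [ih]

theorem dropB_replicate_c (i : ℕ) (p : List Letter) :
    dropB (List.replicate (i + 1) .b ++ .c :: p) = List.replicate i .b ++ .c :: p := by
  induction i with
  | zero => rfl
  | succ i ih =>
    simp only [List.replicate_succ, List.cons_append, dropB] at ih ⊢
    rw [ih]

theorem xWord_replicate (k i : ℕ) : xWord k (List.replicate i .b) = List.replicate i .b := by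
  cases i with
  | zero => rfl
  | succ i => exact dropB_replicate (i + 1)

theorem xWord_replicate_a (k i : ℕ) (p : List Letter) :
    xWord k (List.replicate i .b ++ .a :: p) = List.replicate i .b ++ .a :: p := by
  cases i with
  | zero => rfl
  | succ i => exact dropB_replicate_a (i + 1) p

theorem xWord_c (k : ℕ) (p : List Letter) :
    xWord k (.c :: p) = List.replicate (k - 1) .b ++ .c :: p := rfl

theorem xWord_replicate_c (k i : ℕ) (p : List Letter) :
    xWord k (List.replicate (i + 1) .b ++ .c :: p) = List.replicate i .b ++ .c :: p :=
  dropB_replicate_c i p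

/-- The extension of `xWord k` to words of any length that transforms the first `k` letters. -/
def extWord (k : ℕ) (u : List Letter) : List Letter := xWord k (u.take k) ++ u.drop k

theorem extWord_replicate_append (k : ℕ) (r : List Letter) :
    extWord k (List.replicate k .b ++ r) = List.replicate k .b ++ r := by
  simp [extWord, xWord_replicate]

theorem take_replicate_append {k i : ℕ} (h : i < k) (x : Letter) (p : List Letter) :
    (List.replicate i Letter.b ++ x :: p).take k =
      List.replicate i .b ++ x :: p.take (k - i - 1) := by
  obtain ⟨j, rfl⟩ := Nat.exists_eq_add_of_lt h
  simp [List.take_append, show i + j + 1 - i = j + 1 by omega]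
  omega

theorem drop_replicate_append {k i : ℕ} (h : i < k) (x : Letter) (p : List Letter) :
    (List.replicate i Letter.b ++ x :: p).drop k = p.drop (k - i - 1) := by
  obtain ⟨j, rfl⟩ := Nat.exists_eq_add_of_lt h
  simp [List.drop_append, show i + j + 1 - i = j + 1 by omega]
  omega

theorem replicate_append_eq {k i : ℕ} (h : k ≤ i) (r : List Letter) :
    List.replicate i Letter.b ++ r =
      List.replicate k .b ++ (List.replicate (i - k) .b ++ r) := by
  rw [← List.append_assoc, List.replicate_append_replicate, Nat.add_sub_cancel' h]

theorem extWord_replicate (k i : ℕ) : extWord k (List.replicate i .b) = List.replicate i .b := by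
  simp only [extWord, List.take_replicate, List.drop_replicate, xWord_replicate,
    List.replicate_append_replicate]
  congr 1
  omega

theorem extWord_replicate_a (k i : ℕ) (p : List Letter) :
    extWord k (List.replicate i .b ++ .a :: p) = List.replicate i .b ++ .a :: p := by
  rcases lt_or_ge i k with h | h
  · rw [extWord, take_replicate_append h, drop_replicate_append h, xWord_replicate_a]
    simp
  · rw [replicate_append_eq h, extWord_replicate_append]

theorem extWord_c {k : ℕ} (hk : 0 < k) (p : List Letter) :
    extWord k (.c :: p) = List.replicate (k - 1) .b ++ .c :: p := by
  obtain ⟨k, rfl⟩ := Nat.exists_eq_add_of_lt hk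
  simp [extWord, xWord_c]

theorem extWord_replicate_c {k i : ℕ} (h : i + 1 < k) (p : List Letter) :
    extWord k (List.replicate (i + 1) .b ++ .c :: p) = List.replicate i .b ++ .c :: p := by
  rw [extWord, take_replicate_append h, drop_replicate_append h, xWord_replicate_c]
  simp

/-- Whether a letter is `b`. -/
def isB : Letter → Bool
  | .b => true
  | _ => false

/-- The inverse of `extWord k`: `bⁱ c p ↦ bⁱ⁺¹ c p` for `i < k - 1` and `bᵏ⁻¹ c p ↦ c p`; all other
words are fixed. -/
def raiseB (k : ℕ) (t : List Letter) : List Letter :=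
  match t.dropWhile isB with
  | .c :: p =>
    if (t.takeWhile isB).length + 1 < k then .b :: t
    else if (t.takeWhile isB).length + 1 = k then .c :: p else t
  | _ => t

theorem takeWhile_replicate_append (i : ℕ) (r : List Letter) (hr : r.takeWhile isB = []) :
    (List.replicate i Letter.b ++ r).takeWhile isB = List.replicate i .b := by
  induction i with
  | zero => simpa using hr
  | succ i ih => rw [List.replicate_succ, List.cons_append, List.takeWhile_cons_of_pos rfl, ih]

theorem dropWhile_replicate_append (i : ℕ) (r : List Letter) (hr : r.dropWhile isB = r) :
    (List.replicate i Letter.b ++ r).dropWhile isB = r := by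
  induction i with
  | zero => simpa using hr
  | succ i ih => rw [List.replicate_succ, List.cons_append, List.dropWhile_cons_of_pos rfl, ih]

theorem raiseB_replicate (k i : ℕ) : raiseB k (List.replicate i .b) = List.replicate i .b := by
  have := dropWhile_replicate_append i [] rfl
  rw [List.append_nil] at this
  simp [raiseB, this]

theorem raiseB_replicate_a (k i : ℕ) (p : List Letter) :
    raiseB k (List.replicate i .b ++ .a :: p) = List.replicate i .b ++ .a :: p := by
  simp [raiseB, dropWhile_replicate_append i (.a :: p) rfl]

theorem raiseB_replicate_c (k i : ℕ) (p : List Letter) :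
    raiseB k (List.replicate i .b ++ .c :: p) =
      if i + 1 < k then List.replicate (i + 1) .b ++ .c :: p
      else if i + 1 = k then .c :: p else List.replicate i .b ++ .c :: p := by
  simp [raiseB, dropWhile_replicate_append i (.c :: p) rfl,
    takeWhile_replicate_append i (.c :: p) rfl, List.replicate_succ]

theorem raiseB_extWord {k : ℕ} (hk : 0 < k) (u : List Letter) : raiseB k (extWord k u) = u := by
  rcases word_cases u with ⟨i, rfl⟩ | ⟨i, p, rfl⟩ | ⟨i, p, rfl⟩
  · rw [extWord_replicate, raiseB_replicate]
  · rw [extWord_replicate_a, raiseB_replicate_a]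
  · cases i with
    | zero =>
      rw [List.replicate_zero, List.nil_append, extWord_c hk, raiseB_replicate_c,
        if_neg (by omega), if_pos (by omega)]
    | succ i =>
      rcases lt_or_ge (i + 1) k with h | h
      · rw [extWord_replicate_c h, raiseB_replicate_c, if_pos h]
      · rw [replicate_append_eq h, extWord_replicate_append, ← replicate_append_eq h,
          raiseB_replicate_c, if_neg (by omega), if_neg (by omega)]

theorem extWord_raiseB {k : ℕ} (hk : 0 < k) (t : List Letter) : extWord k (raiseB k t) = t := by
  rcases word_cases t with ⟨i, rfl⟩ | ⟨i, p, rfl⟩ | ⟨i, p, rfl⟩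
  · rw [raiseB_replicate, extWord_replicate]
  · rw [raiseB_replicate_a, extWord_replicate_a]
  · rw [raiseB_replicate_c]
    split_ifs with h1 h2
    · exact extWord_replicate_c h1 p
    · rw [extWord_c hk, ← h2, Nat.add_sub_cancel]
    · rw [replicate_append_eq (by omega : k ≤ i), extWord_replicate_append]

theorem length_raiseB_le (k : ℕ) (t : List Letter) : (raiseB k t).length ≤ t.length + 1 := by
  rcases word_cases t with ⟨i, rfl⟩ | ⟨i, p, rfl⟩ | ⟨i, p, rfl⟩
  · simp [raiseB_replicate]
  · simp [raiseB_replicate_a]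
  · rw [raiseB_replicate_c]
    split_ifs <;> simp <;> omega

/-- The distance of the words `u` and `v`, as vertices of a rooted tree, is at most `k`: they
differ in suffixes of total length at most `k`. -/
def Near (k : ℕ) (u v : List Letter) : Prop :=
  ∃ p u' v', u = p ++ u' ∧ v = p ++ v' ∧ u'.length + v'.length ≤ k

theorem Near.append_left {k : ℕ} {u v : List Letter} (h : Near k u v) (w : List Letter) :
    Near k (w ++ u) (w ++ v) := by
  obtain ⟨p, u', v', rfl, rfl, h⟩ := h
  exact ⟨w ++ p, u', v', by simp, by simp, h⟩

theorem near_concat {k : ℕ} (hk : 0 < k) (u : List Letter) (y : Letter) :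
    Near k u (u ++ [y]) :=
  ⟨u, [], [y], by simp, rfl, hk⟩

/-- Along an edge inside a block, `xWord k` moves the endpoints to distance at most `k`. -/
theorem near_xWord {k : ℕ} (hk : 2 ≤ k) (u : List Letter) (y : Letter) :
    Near k (xWord k u) (xWord k (u ++ [y])) := by
  rcases word_cases u with ⟨i, rfl⟩ | ⟨i, p, rfl⟩ | ⟨i, p, rfl⟩
  · cases y with
    | a =>
      rw [xWord_replicate, xWord_replicate_a]
      exact near_concat (by omega) _ _
    | b =>
      rw [xWord_replicate, ← List.replicate_succ', xWord_replicate, List.replicate_succ']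
      exact near_concat (by omega) _ _
    | c =>
      cases i with
      | zero =>
        exact ⟨[], [], List.replicate (k - 1) .b ++ [.c], rfl, rfl, by simp; omega⟩
      | succ i =>
        rw [xWord_replicate, xWord_replicate_c]
        exact ⟨List.replicate i .b, [.b], [.c], List.replicate_succ', rfl, hk⟩
  · rw [List.append_assoc, List.cons_append, xWord_replicate_a, xWord_replicate_a,
      ← List.cons_append, ← List.append_assoc]
    exact near_concat (by omega) _ _
  · cases i with
    | zero =>
      simp only [List.replicate_zero, List.nil_append, List.cons_append, xWord_c]
      rw [← List.cons_append, ← List.append_assoc]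
      exact near_concat (by omega) _ _
    | succ i =>
      rw [List.append_assoc, List.cons_append, xWord_replicate_c, xWord_replicate_c,
        ← List.cons_append, ← List.append_assoc]
      exact near_concat (by omega) _ _

/-- Along an edge, either `raiseB k` appends the same letter, or both images have length at most
`k` and their distance is at most `k`. -/
theorem raiseB_concat {k : ℕ} (hk : 2 ≤ k) (t : List Letter) (y : Letter) :
    raiseB k (t ++ [y]) = raiseB k t ++ [y] ∨
      (raiseB k t).length ≤ k ∧ (raiseB k (t ++ [y])).length ≤ k ∧
        Near k (raiseB k t) (raiseB k (t ++ [y])) := by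
  rcases word_cases t with ⟨i, rfl⟩ | ⟨i, p, rfl⟩ | ⟨i, p, rfl⟩
  · cases y with
    | a => exact .inl (by rw [raiseB_replicate, raiseB_replicate_a])
    | b =>
      refine .inl ?_
      rw [raiseB_replicate, ← List.replicate_succ', raiseB_replicate]
    | c =>
      rw [raiseB_replicate, raiseB_replicate_c]
      split_ifs with h1 h2
      · refine .inr ⟨by simp; omega, by simp; omega, List.replicate i .b, [], [.b, .c], by simp,
          ?_, by simpa using hk⟩
        simp [List.replicate_succ']
      · exact .inr ⟨by simp; omega, by simp; omega, [], List.replicate i .b, [.c], rfl, rfl,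
          by simp; omega⟩
      · exact .inl rfl
  · refine .inl ?_
    rw [List.append_assoc, List.cons_append, raiseB_replicate_a, raiseB_replicate_a]
    simp
  · refine .inl ?_
    rw [List.append_assoc, List.cons_append, raiseB_replicate_c, raiseB_replicate_c]
    split_ifs <;> simp

open Classical in
/-- The inverse of the transformation of the block at depth `q * C`, for words of any length. -/
noncomputable def unblockWord (C q : ℕ) (t : List Letter) : List Letter :=
  if q ∈ bands then raiseB C t else t

theorem unblockWord_blockWord {C : ℕ} (hC : 0 < C) (q : ℕ) (u : List Letter) :
    unblockWord C q (blockWord C q (u.take C) ++ u.drop C) = u := by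
  unfold unblockWord blockWord
  split_ifs
  · exact raiseB_extWord hC u
  · simp

theorem blockWord_unblockWord {C : ℕ} (hC : 0 < C) (q : ℕ) (t : List Letter) :
    blockWord C q ((unblockWord C q t).take C) ++ (unblockWord C q t).drop C = t := by
  unfold unblockWord blockWord
  split_ifs
  · exact extWord_raiseB hC t
  · simp

theorem length_unblockWord_le (C q : ℕ) (t : List Letter) :
    (unblockWord C q t).length ≤ t.length + 1 := by
  unfold unblockWord
  split_ifs
  · exact length_raiseB_le C t
  · omega

theorem near_blockWord {C : ℕ} (hC : 2 ≤ C) (q : ℕ) (u : List Letter) (y : Letter) :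
    Near C (blockWord C q u) (blockWord C q (u ++ [y])) := by
  unfold blockWord
  split_ifs
  · exact near_xWord hC u y
  · exact near_concat (by omega) u y

theorem unblockWord_concat {C : ℕ} (hC : 2 ≤ C) (q : ℕ) (t : List Letter) (y : Letter) :
    unblockWord C q (t ++ [y]) = unblockWord C q t ++ [y] ∨
      (unblockWord C q t).length ≤ C ∧ (unblockWord C q (t ++ [y])).length ≤ C ∧
        Near C (unblockWord C q t) (unblockWord C q (t ++ [y])) := by
  unfold unblockWord
  split_ifs
  · exact raiseB_concat hC t y
  · exact .inl rfl

theorem blockWord_nil (C q : ℕ) : blockWord C q [] = [] := by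
  simp [blockWord, xWord, dropB]

theorem unblockWord_nil (C q : ℕ) : unblockWord C q [] = [] := by
  simp [unblockWord, raiseB]

theorem belowWord_of_length_le {C : ℕ} (q : ℕ) {u : List Letter} (h : u.length ≤ C) :
    belowWord C q u = blockWord C q u := by
  rw [belowWord, if_pos (.inr h)]

theorem belowWord_nil (C q : ℕ) : belowWord C q [] = [] := by
  rw [belowWord_of_length_le q (Nat.zero_le C), blockWord_nil]

theorem belowWord_eq {C : ℕ} (hC : 0 < C) (q : ℕ) (u : List Letter) :
    belowWord C q u = blockWord C q (u.take C) ++ belowWord C (q + 1) (u.drop C) := by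
  rcases le_or_gt u.length C with h | h
  · rw [belowWord_of_length_le q h, List.take_of_length_le h, List.drop_of_length_le h,
      belowWord_nil, List.append_nil]
  · rw [belowWord, if_neg (by omega)]

/-- The inverse of `belowWord C q` (for `2 ≤ C`): undo the transformation of the first block, and
recurse on what follows it. -/
noncomputable def unbelowWord (C q : ℕ) (t : List Letter) : List Letter :=
  if C < 2 ∨ (unblockWord C q t).length ≤ C then unblockWord C q t
  else (unblockWord C q t).take C ++ unbelowWord C (q + 1) ((unblockWord C q t).drop C)
termination_by t.length
decreasing_by
  have := length_unblockWord_le C q t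
  simp only [List.length_drop]
  omega

theorem unbelowWord_of_length_le {C : ℕ} (q : ℕ) {t : List Letter}
    (h : (unblockWord C q t).length ≤ C) : unbelowWord C q t = unblockWord C q t := by
  rw [unbelowWord, if_pos (.inr h)]

theorem unbelowWord_nil (C q : ℕ) : unbelowWord C q [] = [] := by
  rw [unbelowWord_of_length_le] <;> simp [unblockWord_nil]

theorem unbelowWord_eq {C : ℕ} (hC : 2 ≤ C) (q : ℕ) (t : List Letter) :
    unbelowWord C q t =
      (unblockWord C q t).take C ++ unbelowWord C (q + 1) ((unblockWord C q t).drop C) := by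
  rcases le_or_gt (unblockWord C q t).length C with h | h
  · rw [unbelowWord_of_length_le q h, List.take_of_length_le h, List.drop_of_length_le h,
      unbelowWord_nil, List.append_nil]
  · rw [unbelowWord, if_neg (by omega)]

theorem take_append_eq_and_drop_append_eq {C : ℕ} {u r : List Letter}
    (h : u.drop C = [] → r = []) :
    (u.take C ++ r).take C = u.take C ∧ (u.take C ++ r).drop C = r := by
  rcases le_or_gt u.length C with h' | h'
  · simp [h (List.drop_of_length_le h')]
  · have : (u.take C).length = C := by simp; omega
    exact ⟨List.take_left' this, List.drop_left' this⟩

theorem unbelowWord_belowWord {C : ℕ} (hC : 2 ≤ C) (q : ℕ) (u : List Letter) :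
    unbelowWord C q (belowWord C q u) = u := by
  induction hn : u.length using Nat.strong_induction_on generalizing q u with
  | _ n ih =>
    rcases le_or_gt u.length C with h | h
    · have := unblockWord_blockWord (by omega : 0 < C) q u
      rw [List.take_of_length_le h, List.drop_of_length_le h, List.append_nil] at this
      rw [belowWord_of_length_le q h, unbelowWord_of_length_le] <;> rw [this]
      exact h
    · obtain ⟨h1, h2⟩ := take_append_eq_and_drop_append_eq (C := C) (u := u)
        (r := belowWord C (q + 1) (u.drop C)) (by intro h; rw [h, belowWord_nil])
      have := unblockWord_blockWord (by omega : 0 < C) q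
        (u.take C ++ belowWord C (q + 1) (u.drop C))
      rw [h1, h2, ← belowWord_eq (by omega)] at this
      rw [unbelowWord_eq hC, this, h1, h2, ih _ _ _ _ rfl, List.take_append_drop]
      simp; omega

theorem belowWord_unbelowWord {C : ℕ} (hC : 2 ≤ C) (q : ℕ) (t : List Letter) :
    belowWord C q (unbelowWord C q t) = t := by
  induction hn : t.length using Nat.strong_induction_on generalizing q t with
  | _ n ih =>
    have hb := blockWord_unblockWord (by omega : 0 < C) q t
    have hl := length_unblockWord_le C q t
    rcases le_or_gt (unblockWord C q t).length C with h | h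
    · rw [List.take_of_length_le h, List.drop_of_length_le h, List.append_nil] at hb
      rw [unbelowWord_of_length_le q h, belowWord_of_length_le q h, hb]
    · obtain ⟨h1, h2⟩ := take_append_eq_and_drop_append_eq (C := C) (u := unblockWord C q t)
        (r := unbelowWord C (q + 1) ((unblockWord C q t).drop C))
        (by intro h; rw [h, unbelowWord_nil])
      rw [unbelowWord_eq hC, belowWord_eq (by omega), h1, h2, ih _ _ _ _ rfl, hb]
      simp; omega

theorem near_belowWord {C : ℕ} (hC : 2 ≤ C) (q : ℕ) (u : List Letter) (y : Letter) :
    Near C (belowWord C q u) (belowWord C q (u ++ [y])) := by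
  induction hn : u.length using Nat.strong_induction_on generalizing q u with
  | _ n ih =>
    rcases lt_or_ge u.length C with h | h
    · rw [belowWord_of_length_le q h.le, belowWord_of_length_le q (by simpa using h)]
      exact near_blockWord hC q u y
    · rw [belowWord_eq (by omega) q u, belowWord_eq (by omega) q (u ++ [y]),
        List.take_append_of_le_length h, List.drop_append_of_le_length h]
      exact (ih _ (by simp; omega) _ _ rfl).append_left _

theorem near_unbelowWord {C : ℕ} (hC : 2 ≤ C) (q : ℕ) (t : List Letter) (y : Letter) :
    Near C (unbelowWord C q t) (unbelowWord C q (t ++ [y])) := by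
  induction hn : t.length using Nat.strong_induction_on generalizing q t with
  | _ n ih =>
    have hl := length_unblockWord_le C q t
    rcases unblockWord_concat hC q t y with h | ⟨h1, h2, h3⟩
    · rcases lt_or_ge (unblockWord C q t).length C with h' | h'
      · rw [unbelowWord_of_length_le q h'.le, unbelowWord_of_length_le q (by simpa [h] using h'), h]
        exact near_concat (by omega) _ _
      · rw [unbelowWord_eq hC q t, unbelowWord_eq hC q (t ++ [y]), h,
          List.take_append_of_le_length h', List.drop_append_of_le_length h']
        exact (ih _ (by simp; omega) _ _ rfl).append_left _
    · rwa [unbelowWord_of_length_le q h1, unbelowWord_of_length_le q h2]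

/-- Replace the part of a vertex below depth `C` by its image under `F`. -/
def mapBelow (C : ℕ) (F : List Letter → List Letter) : Vertex → Vertex
  | none => none
  | some (x, u) => some (x, u.take (C - 1) ++ F (u.drop (C - 1)))

theorem onVertex_eq_mapBelow (C : ℕ) : onVertex C = mapBelow C (belowWord C 1) := by
  funext v
  rcases v with _ | ⟨x, u⟩ <;> rfl

theorem mapBelow_mapBelow (C : ℕ) {F G : List Letter → List Letter} (h : ∀ u, G (F u) = u)
    (hF : F [] = []) (v : Vertex) : mapBelow C G (mapBelow C F v) = v := by
  rcases v with _ | ⟨x, u⟩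
  · rfl
  · obtain ⟨h1, h2⟩ := take_append_eq_and_drop_append_eq (C := C - 1) (u := u)
      (r := F (u.drop (C - 1))) (by intro h; rw [h, hF])
    simp only [mapBelow, h1, h2, h, List.take_append_drop]

theorem near_mapBelow {C : ℕ} (hC : 0 < C) {F : List Letter → List Letter} (hF : F [] = [])
    (h : ∀ u y, Near C (F u) (F (u ++ [y]))) (u : List Letter) (y : Letter) :
    Near C (u.take (C - 1) ++ F (u.drop (C - 1)))
      ((u ++ [y]).take (C - 1) ++ F ((u ++ [y]).drop (C - 1))) := by
  rcases lt_or_ge u.length (C - 1) with h' | h'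
  · have h'' : (u ++ [y]).length ≤ C - 1 := by simpa using h'
    rw [List.take_of_length_le h'.le, List.drop_of_length_le h'.le, List.take_of_length_le h'',
      List.drop_of_length_le h'', hF, List.append_nil, List.append_nil]
    exact near_concat hC u y
  · rw [List.take_append_of_le_length h', List.drop_append_of_le_length h']
    exact (h _ _).append_left _

/-- `onVertex C` is a bijection. -/
noncomputable def onVertexEquiv (C : ℕ) (hC : 2 ≤ C) : Vertex ≃ Vertex where
  toFun := mapBelow C (belowWord C 1)
  invFun := mapBelow C (unbelowWord C 1)
  left_inv := mapBelow_mapBelow C (unbelowWord_belowWord hC 1) (belowWord_nil C 1)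
  right_inv := mapBelow_mapBelow C (belowWord_unbelowWord hC 1) (unbelowWord_nil C 1)

/-! ### The word metric and the tree structure -/

theorem wordDist_self (g : F2) : wordDist g g = 0 := by simp [wordDist]

theorem wordDist_comm (g h : F2) : wordDist g h = wordDist h g := by
  rw [wordDist, wordDist, ← FreeGroup.norm_inv_eq, mul_inv_rev, inv_inv]

theorem wordDist_triangle (g h k : F2) : wordDist g k ≤ wordDist g h + wordDist h k := by
  have := FreeGroup.norm_mul_le (g⁻¹ * h) (h⁻¹ * k)
  rwa [mul_assoc, mul_inv_cancel_left] at this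

theorem exists_mul_mk_of_wordDist_eq_one {g h : F2} (hgh : wordDist g h = 1) :
    ∃ s, g * FreeGroup.mk [s] = h := by
  obtain ⟨s, hs⟩ := List.length_eq_one_iff.1 hgh
  exact ⟨s, by rw [← hs, FreeGroup.mk_toWord, mul_inv_cancel_left]⟩

/-- A pseudometric `δ` on `F₂` that is at most `K` on the edges of the Cayley graph is at most
`K` times the word metric. -/
theorem le_mul_wordDist {δ : F2 → F2 → ℕ} (hself : ∀ g, δ g g = 0)
    (htri : ∀ g h k, δ g k ≤ δ g h + δ h k) {K : ℕ}
    (hK : ∀ g s, δ g (g * FreeGroup.mk [s]) ≤ K) (g h : F2) : δ g h ≤ K * wordDist g h := by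
  have key : ∀ (l : List (Fin 2 × Bool)) (g : F2), δ g (g * FreeGroup.mk l) ≤ K * l.length := by
    intro l
    induction l with
    | nil =>
      intro g
      rw [← FreeGroup.one_eq_mk, mul_one, hself]
      exact Nat.zero_le _
    | cons s l ih =>
      intro g
      have h1 := htri g (g * FreeGroup.mk [s]) (g * FreeGroup.mk (s :: l))
      have h2 := ih (g * FreeGroup.mk [s])
      rw [mul_assoc, FreeGroup.mul_mk, List.singleton_append] at h2
      have h3 := hK g s
      rw [List.length_cons]
      linarith
  have := key (g⁻¹ * h).toWord g
  rwa [FreeGroup.mk_toWord, mul_inv_cancel_left] at this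

/-- The parent of the vertex `some (x, u)`. -/
def parent (x : Fin 4) (u : List Letter) : Vertex :=
  if u = [] then none else some (x, u.dropLast)

/-- The four neighbours of a vertex in the tree. -/
def neighbour : Vertex → Fin 4 → Vertex
  | none => fun i => some (i, [])
  | some (x, u) => ![parent x u, some (x, u ++ [.a]), some (x, u ++ [.b]), some (x, u ++ [.c])]

/-- The distance of a vertex from the root. -/
def depth : Vertex → ℕ
  | none => 0
  | some (_, u) => u.length + 1

theorem depth_parent (x : Fin 4) (u : List Letter) : depth (parent x u) = u.length := by
  unfold parent
  split_ifs with h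
  · simp [h, depth]
  · have := List.length_pos_iff.2 h
    simp [depth]
    omega

theorem neighbour_injective (v : Vertex) : Function.Injective (neighbour v) := by
  rcases v with _ | ⟨x, u⟩
  · intro i j h
    simpa [neighbour] using h
  · have hp : ∀ y, parent x u ≠ some (x, u ++ [y]) := by
      intro y h
      have := congrArg depth h
      rw [depth_parent] at this
      simp only [depth, List.length_append, List.length_singleton] at this
      omega
    intro i j h
    fin_cases i <;> fin_cases j <;>
      first
        | rfl
        | exact absurd h (hp _)
        | exact absurd h.symm (hp _)
        | simp [neighbour] at h

/-- A symmetric relation that holds between each vertex and its children holds between all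
neighbours. -/
theorem forall_neighbour {r : Vertex → Vertex → Prop} (hsymm : ∀ v w, r v w → r w v)
    (hroot : ∀ x, r none (some (x, []))) (hchild : ∀ x u y, r (some (x, u)) (some (x, u ++ [y])))
    (v : Vertex) (i : Fin 4) : r v (neighbour v i) := by
  rcases v with _ | ⟨x, u⟩
  · exact hroot i
  · fin_cases i
    · change r _ (parent x u)
      unfold parent
      split_ifs with h
      · subst h
        exact hsymm _ _ (hroot x)
      · refine hsymm _ _ ?_
        conv => arg 2; rw [← List.dropLast_append_getLast h]
        exact hchild _ _ _
    all_goals exact hchild _ _ _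

variable (Λ : Labelling)

theorem Labelling.wordDist_neighbour (v : Vertex) (i : Fin 4) :
    wordDist (Λ.toEquiv v) (Λ.toEquiv (neighbour v i)) = 1 :=
  forall_neighbour (r := fun v w => wordDist (Λ.toEquiv v) (Λ.toEquiv w) = 1)
    (fun _ _ h => by rwa [wordDist_comm]) Λ.adj_root Λ.adj_child v i

/-- The neighbours in the Cayley graph are the neighbours in the tree. -/
theorem Labelling.exists_equiv_neighbour (v : Vertex) :
    ∃ σ : Fin 4 ≃ Fin 2 × Bool, ∀ i,
      Λ.toEquiv v * FreeGroup.mk [σ i] = Λ.toEquiv (neighbour v i) := by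
  choose σ hσ using fun i => exists_mul_mk_of_wordDist_eq_one (Λ.wordDist_neighbour v i)
  have hinj : Function.Injective σ := by
    intro i j h
    apply neighbour_injective v
    apply Λ.toEquiv.injective
    rw [← hσ, ← hσ, h]
  exact ⟨Equiv.ofBijective σ ((Fintype.bijective_iff_injective_and_card σ).2 ⟨hinj, by simp⟩), hσ⟩

/-- A pseudometric on vertices that is at most `K` between each vertex and its children is at most
`K` times the word metric. -/
theorem Labelling.le_mul_wordDist {δ : Vertex → Vertex → ℕ} (hself : ∀ v, δ v v = 0)
    (hcomm : ∀ v w, δ v w = δ w v) (htri : ∀ u v w, δ u w ≤ δ u v + δ v w) {K : ℕ}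
    (hroot : ∀ x, δ none (some (x, [])) ≤ K)
    (hchild : ∀ x u y, δ (some (x, u)) (some (x, u ++ [y])) ≤ K) (v w : Vertex) :
    δ v w ≤ K * wordDist (Λ.toEquiv v) (Λ.toEquiv w) := by
  have := ChristmasTree.le_mul_wordDist (K := K)
    (δ := fun g h => δ (Λ.toEquiv.symm g) (Λ.toEquiv.symm h)) (fun _ => hself _)
    (fun _ _ _ => htri _ _ _) ?_ (Λ.toEquiv v) (Λ.toEquiv w)
  · simpa using this
  · intro g s
    obtain ⟨σ, hσ⟩ := Λ.exists_equiv_neighbour (Λ.toEquiv.symm g)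
    have := hσ (σ.symm s)
    simp only [Equiv.apply_symm_apply] at this
    rw [this, Equiv.symm_apply_apply]
    exact forall_neighbour (r := fun v w => δ v w ≤ K) (fun _ _ h => by rwa [hcomm]) hroot hchild
      _ _

theorem Labelling.wordDist_one (v : Vertex) : wordDist 1 (Λ.toEquiv v) = depth v := by
  apply le_antisymm
  · rcases v with _ | ⟨x, u⟩
    · rw [Λ.map_root, wordDist_self]
      exact Nat.zero_le _
    · rw [← Λ.map_root]
      induction u using List.reverseRecOn with
      | nil => exact (Λ.adj_root x).le
      | append_singleton u y ih =>
        have h1 := wordDist_triangle (Λ.toEquiv none) (Λ.toEquiv (some (x, u)))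
          (Λ.toEquiv (some (x, u ++ [y])))
        have h2 := Λ.adj_child x u y
        simp only [depth, List.length_append, List.length_singleton] at ih ⊢
        omega
  · have := Λ.le_mul_wordDist (K := 1) (δ := fun v w => (depth v - depth w) + (depth w - depth v))
      (by simp) (fun _ _ => add_comm _ _) (fun _ _ _ => by omega) (fun _ => by simp [depth])
      (fun _ _ _ => by simp [depth]) none v
    simpa [Λ.map_root, depth] using this

theorem Labelling.wordDist_append_le (x : Fin 4) (p u : List Letter) :
    wordDist (Λ.toEquiv (some (x, p))) (Λ.toEquiv (some (x, p ++ u))) ≤ u.length := by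
  induction u using List.reverseRecOn with
  | nil => simp [wordDist_self]
  | append_singleton u y ih =>
    have h1 := wordDist_triangle (Λ.toEquiv (some (x, p))) (Λ.toEquiv (some (x, p ++ u)))
      (Λ.toEquiv (some (x, p ++ u ++ [y])))
    have h2 := Λ.adj_child x (p ++ u) y
    rw [← List.append_assoc, List.length_append, List.length_singleton]
    omega

theorem Labelling.wordDist_le_of_near (x : Fin 4) {k : ℕ} {u v : List Letter} (h : Near k u v) :
    wordDist (Λ.toEquiv (some (x, u))) (Λ.toEquiv (some (x, v))) ≤ k := by
  obtain ⟨p, u', v', rfl, rfl, h⟩ := h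
  have h1 := Λ.wordDist_append_le x p u'
  have h2 := Λ.wordDist_append_le x p v'
  have h3 := wordDist_triangle (Λ.toEquiv (some (x, p ++ u'))) (Λ.toEquiv (some (x, p)))
    (Λ.toEquiv (some (x, p ++ v')))
  rw [wordDist_comm _ (Λ.toEquiv (some (x, p)))] at h3
  omega

theorem Labelling.wordDist_mapBelow_le {C : ℕ} (hC : 0 < C) {F : List Letter → List Letter}
    (hF : F [] = []) (h : ∀ u y, Near C (F u) (F (u ++ [y]))) (v w : Vertex) :
    wordDist (Λ.toEquiv (mapBelow C F v)) (Λ.toEquiv (mapBelow C F w)) ≤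
      C * wordDist (Λ.toEquiv v) (Λ.toEquiv w) := by
  refine Λ.le_mul_wordDist
    (δ := fun v w => wordDist (Λ.toEquiv (mapBelow C F v)) (Λ.toEquiv (mapBelow C F w)))
    (fun _ => wordDist_self _) (fun _ _ => wordDist_comm _ _)
    (fun _ _ _ => wordDist_triangle _ _ _) ?_ ?_ v w
  · intro x
    simp only [mapBelow, List.take_nil, List.drop_nil, hF, List.append_nil, Λ.adj_root]
    exact hC
  · intro x u y
    exact Λ.wordDist_le_of_near x (near_mapBelow hC hF h u y)

/-- The Christmas tree map as a bijection. -/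
noncomputable def christmasTreeEquiv (C : ℕ) (hC : 2 ≤ C) : F2 ≃ F2 :=
  (Λ.toEquiv.symm.trans (onVertexEquiv C hC)).trans Λ.toEquiv

theorem christmasTreeEquiv_apply (C : ℕ) (hC : 2 ≤ C) (v : Vertex) :
    christmasTreeEquiv Λ C hC (Λ.toEquiv v) = Λ.toEquiv (mapBelow C (belowWord C 1) v) := by
  simp [christmasTreeEquiv, onVertexEquiv]

theorem christmasTreeEquiv_eq (C : ℕ) (hC : 2 ≤ C) (g : F2) :
    christmasTreeEquiv Λ C hC g = christmasTree Λ C g := by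
  rw [christmasTree, onVertex_eq_mapBelow, ← christmasTreeEquiv_apply, Equiv.apply_symm_apply]

theorem christmasTreeEquiv_one (C : ℕ) (hC : 2 ≤ C) : christmasTreeEquiv Λ C hC 1 = 1 := by
  rw [← Λ.map_root, christmasTreeEquiv_apply, mapBelow]

theorem isQuasiIsometry_christmasTreeEquiv (C : ℕ) (hC : 2 ≤ C) :
    IsQuasiIsometry C 0 (christmasTreeEquiv Λ C hC) := by
  refine ⟨fun g h => ?_, fun y => ⟨(christmasTreeEquiv Λ C hC).symm y, by simp [wordDist_self]⟩⟩
  obtain ⟨v, rfl⟩ := Λ.toEquiv.surjective g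
  obtain ⟨w, rfl⟩ := Λ.toEquiv.surjective h
  rw [christmasTreeEquiv_apply, christmasTreeEquiv_apply]
  have hC' : (0 : ℝ) < C := by positivity
  have h1 := Λ.wordDist_mapBelow_le (by omega) (belowWord_nil C 1) (near_belowWord hC 1) v w
  have h2 := Λ.wordDist_mapBelow_le (by omega) (unbelowWord_nil C 1) (near_unbelowWord hC 1)
    (mapBelow C (belowWord C 1) v) (mapBelow C (belowWord C 1) w)
  rw [mapBelow_mapBelow C (unbelowWord_belowWord hC 1) (belowWord_nil C 1),
    mapBelow_mapBelow C (unbelowWord_belowWord hC 1) (belowWord_nil C 1)] at h2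
  constructor
  · rw [sub_zero, div_le_iff₀' hC']
    exact_mod_cast h2
  · rw [add_zero]
    exact_mod_cast h1

/-! ### Averages over spheres and the distance process of the random walk -/

/-- The average of `F` over the `3 ^ n` words of length `n`, by recursion on the first letter. -/
noncomputable def wordAvg : ℕ → (List Letter → ℝ) → ℝ
  | 0, F => F []
  | n + 1, F => (wordAvg n (fun u => F (.a :: u)) + wordAvg n (fun u => F (.b :: u)) +
      wordAvg n (fun u => F (.c :: u))) / 3

theorem wordAvg_mono (n : ℕ) {F G : List Letter → ℝ} (h : ∀ u, u.length = n → F u ≤ G u) :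
    wordAvg n F ≤ wordAvg n G := by
  induction n generalizing F G with
  | zero => exact h [] rfl
  | succ n ih =>
    have h' : ∀ y, wordAvg n (fun u => F (y :: u)) ≤ wordAvg n (fun u => G (y :: u)) :=
      fun y => ih fun u hu => h _ (by simp [hu])
    have := h' .a
    have := h' .b
    have := h' .c
    simp only [wordAvg]
    linarith

theorem wordAvg_congr (n : ℕ) {F G : List Letter → ℝ} (h : ∀ u, u.length = n → F u = G u) :
    wordAvg n F = wordAvg n G :=
  le_antisymm (wordAvg_mono n fun u hu => (h u hu).le) (wordAvg_mono n fun u hu => (h u hu).ge)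

theorem wordAvg_const (n : ℕ) (r : ℝ) : wordAvg n (fun _ => r) = r := by
  induction n with
  | zero => rfl
  | succ n ih =>
    simp only [wordAvg, ih]
    ring

theorem wordAvg_add (n : ℕ) (F G : List Letter → ℝ) :
    wordAvg n (fun u => F u + G u) = wordAvg n F + wordAvg n G := by
  induction n generalizing F G with
  | zero => rfl
  | succ n ih =>
    simp only [wordAvg, ih]
    ring

theorem wordAvg_mul_left (n : ℕ) (r : ℝ) (F : List Letter → ℝ) :
    wordAvg n (fun u => r * F u) = r * wordAvg n F := by
  induction n generalizing F with
  | zero => rfl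
  | succ n ih =>
    simp only [wordAvg, ih]
    ring

theorem wordAvg_append (m n : ℕ) (F : List Letter → ℝ) :
    wordAvg (m + n) F = wordAvg m fun u => wordAvg n fun v => F (u ++ v) := by
  induction m generalizing F with
  | zero => simp [wordAvg]
  | succ m ih => simp only [Nat.succ_add, wordAvg, ih, List.cons_append]

theorem wordAvg_succ (n : ℕ) (F : List Letter → ℝ) :
    wordAvg (n + 1) F =
      wordAvg n fun u => 3⁻¹ * (F (u ++ [.a]) + F (u ++ [.b]) + F (u ++ [.c])) := by
  rw [wordAvg_append]
  refine wordAvg_congr n fun u _ => ?_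
  simp only [wordAvg]
  ring

/-- The average of `G` over the vertices at distance `m` from the root. -/
noncomputable def sphereAvg : ℕ → (Vertex → ℝ) → ℝ
  | 0, G => G none
  | n + 1, G => (∑ x : Fin 4, wordAvg n fun u => G (some (x, u))) / 4

/-- The Markov operator of the simple random walk on vertices. -/
noncomputable def vertexOp (G : Vertex → ℝ) (v : Vertex) : ℝ := (∑ i, G (neighbour v i)) / 4

/-- The Markov operator of the distance of the simple random walk from the root. -/
noncomputable def radialOp (φ : ℕ → ℝ) : ℕ → ℝ
  | 0 => φ 1
  | m + 1 => φ m / 4 + 3 * φ (m + 2) / 4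

theorem sum_wordAvg_parent (n : ℕ) (G : Vertex → ℝ) :
    (∑ x, wordAvg n fun u => G (parent x u)) / 4 = sphereAvg n G := by
  cases n with
  | zero =>
    simp [wordAvg, parent, sphereAvg]
  | succ n =>
    simp only [sphereAvg]
    congr 1
    refine Finset.sum_congr rfl fun x _ => ?_
    rw [wordAvg_succ]
    refine wordAvg_congr n fun u _ => ?_
    have h : ∀ y, parent x (u ++ [y]) = some (x, u) := by simp [parent]
    rw [h, h, h]
    ring

/-- Averaging over spheres intertwines the two Markov operators, because the tree looks the same
from all vertices of a sphere. -/
theorem sphereAvg_vertexOp (G : Vertex → ℝ) (n : ℕ) :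
    sphereAvg n (vertexOp G) = radialOp (fun m => sphereAvg m G) n := by
  cases n with
  | zero => simp [sphereAvg, vertexOp, radialOp, wordAvg, neighbour]
  | succ n =>
    have h : ∀ x, (wordAvg n fun u => vertexOp G (some (x, u))) =
        4⁻¹ * (wordAvg n fun u => G (parent x u)) +
          3 / 4 * wordAvg (n + 1) fun u => G (some (x, u)) := by
      intro x
      rw [wordAvg_succ, ← wordAvg_mul_left, ← wordAvg_mul_left, ← wordAvg_add]
      refine wordAvg_congr n fun u _ => ?_
      simp [vertexOp, neighbour, Fin.sum_univ_four]
      ring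
    simp only [radialOp, ← sum_wordAvg_parent n G]
    simp only [sphereAvg, h, Finset.sum_add_distrib, ← Finset.mul_sum]
    ring

theorem iterate_vertexOp_none (n : ℕ) (G : Vertex → ℝ) :
    vertexOp^[n] G none = radialOp^[n] (fun m => sphereAvg m G) 0 := by
  induction n generalizing G with
  | zero => rfl
  | succ n ih =>
    rw [Function.iterate_succ_apply, Function.iterate_succ_apply, ih]
    exact congrArg (fun φ => radialOp^[n] φ 0) (funext (sphereAvg_vertexOp G))

/-- Second moment bound for the distance process: its square distance from the linear function
`n / 2` has expectation at most `3 * n / 4` at time `n`. The reflection at the root only pushes the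
process towards its mean, as it is not above it there. -/
theorem abs_iterate_radialOp_sub_le (n : ℕ) {φ : ℕ → ℝ} {r E B : ℝ} (hB : 0 ≤ B)
    (h : ∀ m : ℕ, |φ m - r| ≤ E + B * (m - n / 2) ^ 2) :
    |radialOp^[n] φ 0 - r| ≤ E + B * (3 * n / 4) := by
  induction n generalizing φ E with
  | zero => simpa using h 0
  | succ n ih =>
    rw [Function.iterate_succ_apply]
    refine (ih (E := E + B * (3 / 4)) fun m => ?_).trans (le_of_eq (by push_cast; ring))
    cases m with
    | zero =>
      refine (h 1).trans ?_
      have : (0 : ℝ) ≤ B * n := by positivity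
      push_cast
      nlinarith
    | succ m =>
      have h1 := abs_le.1 (h m)
      have h2 := abs_le.1 (h (m + 2))
      simp only [radialOp]
      push_cast at h1 h2 ⊢
      rw [abs_le]
      constructor <;> nlinarith

/-- A Lipschitz function of the distance process at an even time `2 * M` is on average within
`O(√M)` of its value at `M`. -/
theorem abs_iterate_radialOp_sub_le_sqrt {φ : ℕ → ℝ} {K : ℝ} (hK : 0 ≤ K) {M : ℕ} (hM : 0 < M)
    (h : ∀ m : ℕ, |φ m - φ M| ≤ K * |(m : ℝ) - M|) :
    |radialOp^[2 * M] φ 0 - φ M| ≤ K * √(2 * M : ℕ) := by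
  set s := √(2 * M : ℕ) with hs
  have hs0 : 0 < s := by positivity
  have hs2 : s ^ 2 = (2 * M : ℕ) := Real.sq_sqrt (by positivity)
  have := abs_iterate_radialOp_sub_le (2 * M) (φ := φ) (r := φ M) (E := K * s / 2)
    (B := K / (2 * s)) (by positivity) fun m => ?_
  · refine this.trans ?_
    rw [← hs2]
    have : K * s / 2 + K / (2 * s) * (3 * s ^ 2 / 4) = 7 / 8 * (K * s) := by
      field_simp
      ring
    rw [this]
    have : 0 ≤ K * s := by positivity
    linarith
  · refine (h m).trans ?_
    -- the inequality of arithmetic and geometric means, with weight `s`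
    have key : |(m : ℝ) - M| ≤ s / 2 + (m - M) ^ 2 / (2 * s) := by
      rw [← sub_nonneg, ← sq_abs ((m : ℝ) - M)]
      have : s / 2 + |(m : ℝ) - M| ^ 2 / (2 * s) - |(m : ℝ) - M| =
          (s - |(m : ℝ) - M|) ^ 2 / (2 * s) := by
        field_simp
        ring
      rw [this]
      positivity
    calc K * |(m : ℝ) - M| ≤ K * (s / 2 + (m - M) ^ 2 / (2 * s)) := by gcongr
      _ = _ := by push_cast; ring

theorem abs_sphereAvg_succ_sub_le {G : Vertex → ℝ} {K : ℝ}
    (hroot : ∀ x, |G (some (x, [])) - G none| ≤ K)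
    (hchild : ∀ x u y, |G (some (x, u ++ [y])) - G (some (x, u))| ≤ K) (m : ℕ) :
    |sphereAvg (m + 1) G - sphereAvg m G| ≤ K := by
  have key : ∀ x, |(wordAvg m fun u => G (some (x, u))) - wordAvg m fun u => G (parent x u)| ≤
      K := by
    have hp : ∀ x u, |G (some (x, u)) - G (parent x u)| ≤ K := by
      intro x u
      unfold parent
      split_ifs with h
      · subst h
        exact hroot x
      · conv => lhs; arg 1; arg 1; rw [← List.dropLast_append_getLast h]
        exact hchild _ _ _
    intro x
    have h1 := wordAvg_mono m (F := fun u => G (some (x, u))) (G := fun u => G (parent x u) + K)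
      fun u _ => by linarith [(abs_le.1 (hp x u)).2]
    have h2 := wordAvg_mono m (F := fun u => G (parent x u)) (G := fun u => G (some (x, u)) + K)
      fun u _ => by linarith [(abs_le.1 (hp x u)).1]
    rw [wordAvg_add, wordAvg_const] at h1 h2
    rw [abs_le]
    constructor <;> linarith
  rw [← sum_wordAvg_parent m G]
  simp only [sphereAvg, Fin.sum_univ_four]
  have h0 := abs_le.1 (key 0)
  have h1 := abs_le.1 (key 1)
  have h2 := abs_le.1 (key 2)
  have h3 := abs_le.1 (key 3)
  rw [abs_le]
  constructor <;> linarith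

theorem abs_sub_le_mul_of_abs_succ_sub_le {φ : ℕ → ℝ} {K : ℝ}
    (h : ∀ m, |φ (m + 1) - φ m| ≤ K) (m n : ℕ) : |φ m - φ n| ≤ K * |(m : ℝ) - n| := by
  have key : ∀ m k : ℕ, |φ (m + k) - φ m| ≤ K * k := by
    intro m k
    induction k with
    | zero => simp
    | succ k ih =>
      have h1 := abs_sub_le (φ (m + (k + 1))) (φ (m + k)) (φ m)
      have h2 := h (m + k)
      rw [← add_assoc] at h1 ⊢
      push_cast
      linarith
  rcases le_total n m with hmn | hmn <;> obtain ⟨k, rfl⟩ := Nat.exists_eq_add_of_le hmn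
  · simpa using key n k
  · rw [abs_sub_comm]
    simpa using key m k

/-! ### The average depth of the image of a sphere -/

/-- The average depth of the images under the Christmas tree map of the vertices at depth `m`. -/
noncomputable def meanDepth (C m : ℕ) : ℝ :=
  sphereAvg m fun v => (depth (mapBelow C (belowWord C 1) v) : ℝ)

theorem Near.abs_length_sub_le {k : ℕ} {u v : List Letter} (h : Near k u v) :
    |(v.length : ℝ) - u.length| ≤ k := by
  obtain ⟨p, u', v', rfl, rfl, h⟩ := h
  have h' : (u'.length : ℝ) + v'.length ≤ k := by exact_mod_cast h
  have h1 : (0 : ℝ) ≤ u'.length := by positivity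
  have h2 : (0 : ℝ) ≤ v'.length := by positivity
  simp only [List.length_append, Nat.cast_add]
  rw [abs_le]
  constructor <;> linarith

theorem abs_meanDepth_sub_le {C : ℕ} (hC : 2 ≤ C) (m n : ℕ) :
    |meanDepth C m - meanDepth C n| ≤ C * |(m : ℝ) - n| := by
  refine abs_sub_le_mul_of_abs_succ_sub_le (abs_sphereAvg_succ_sub_le ?_ ?_) m n
  · intro x
    simp only [mapBelow, depth, List.take_nil, List.drop_nil, belowWord_nil]
    norm_num
    omega
  · intro x u y
    have := (near_mapBelow (by omega) (belowWord_nil C 1) (near_belowWord hC 1) u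
      y).abs_length_sub_le
    simpa [mapBelow, depth] using this

/-- The average length of the image of a block at depth `q * C`. -/
noncomputable def meanBlock (C q : ℕ) : ℝ := wordAvg C fun u => ((blockWord C q u).length : ℝ)

/-- The average length of the image of a block under `xWord C`. -/
noncomputable def meanX (C : ℕ) : ℝ := wordAvg C fun u => ((xWord C u).length : ℝ)

open Classical in
theorem meanBlock_eq (C q : ℕ) : meanBlock C q = C + if q ∈ bands then meanX C - C else 0 := by
  unfold meanBlock meanX blockWord
  split_ifs
  · ring
  · rw [wordAvg_congr C (G := fun _ => (C : ℝ)) fun u hu => by rw [hu], wordAvg_const, add_zero]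

theorem length_le_length_dropB (u : List Letter) : u.length ≤ (dropB u).length + 1 := by
  rcases word_cases u with ⟨i, rfl⟩ | ⟨i, p, rfl⟩ | ⟨i, p, rfl⟩
  · simp [dropB_replicate]
  · simp [dropB_replicate_a]
  · cases i with
    | zero => simp [dropB]
    | succ i => simp [dropB_replicate_c]; omega

/-- On average `xWord C` increases the length: the words `b ⋯` lose at most one letter, and the
equally many words `c ⋯` gain `C - 1`. -/
theorem lt_meanX {C : ℕ} (hC : 3 ≤ C) : (C : ℝ) < meanX C := by
  obtain ⟨k, rfl⟩ : ∃ k, C = k + 1 := ⟨C - 1, by omega⟩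
  have ha := wordAvg_mono k (F := fun _ => (k : ℝ) + 1)
    (G := fun u => ((xWord (k + 1) (.a :: u)).length : ℝ)) fun u hu => by
      simp [xWord, dropB, hu]
  have hb := wordAvg_mono k (F := fun _ => (k : ℝ))
    (G := fun u => ((xWord (k + 1) (.b :: u)).length : ℝ)) fun u hu => by
      have := length_le_length_dropB (.b :: u)
      simp only [List.length_cons, hu] at this
      exact_mod_cast Nat.le_of_succ_le_succ this
  have hc := wordAvg_mono k (F := fun _ => 2 * (k : ℝ) + 1)
    (G := fun u => ((xWord (k + 1) (.c :: u)).length : ℝ)) fun u hu => by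
      simp [xWord, hu]
      linarith
  rw [wordAvg_const] at ha hb hc
  have hk : (2 : ℝ) ≤ k := by exact_mod_cast (by omega : 2 ≤ k)
  simp only [meanX, wordAvg]
  push_cast
  linarith

theorem wordAvg_length_belowWord {C : ℕ} (hC : 0 < C) (q j : ℕ) :
    (wordAvg (j * C) fun u => ((belowWord C q u).length : ℝ)) =
      ∑ i ∈ Finset.range j, meanBlock C (q + i) := by
  induction j generalizing q with
  | zero => simp [wordAvg, belowWord_nil]
  | succ j ih =>
    rw [Finset.sum_range_succ', Nat.succ_mul, add_comm, wordAvg_append]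
    have h : (∑ i ∈ Finset.range j, meanBlock C (q + (i + 1))) =
        wordAvg (j * C) fun u => ((belowWord C (q + 1) u).length : ℝ) := by
      rw [ih]
      exact Finset.sum_congr rfl fun i _ => by rw [add_assoc, add_comm 1 i]
    rw [h, add_zero, add_comm, meanBlock,
      ← wordAvg_const C (wordAvg (j * C) fun u => ((belowWord C (q + 1) u).length : ℝ)),
      ← wordAvg_add]
    refine wordAvg_congr C fun u hu => ?_
    rw [← wordAvg_const (j * C) ((blockWord C q u).length : ℝ), ← wordAvg_add]
    refine wordAvg_congr _ fun v _ => ?_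
    rw [belowWord_eq hC, List.take_left' hu, List.drop_left' hu]
    simp

theorem zero_notMem_bands : 0 ∉ bands := by
  rintro ⟨n, h, -⟩
  have : 0 < 8 ^ (2 * n) := by positivity
  omega

theorem meanDepth_mul {C : ℕ} (hC : 0 < C) (q : ℕ) :
    meanDepth C (q * C) = ∑ i ∈ Finset.range q, meanBlock C i := by
  cases q with
  | zero => simp [meanDepth, sphereAvg, mapBelow, depth]
  | succ q =>
    obtain ⟨n, hn⟩ : ∃ n, C = n + 1 := ⟨C - 1, by omega⟩
    have h : (q + 1) * C = n + q * C + 1 := by rw [Nat.succ_mul]; omega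
    rw [Finset.sum_range_succ', meanBlock_eq C 0, if_neg zero_notMem_bands]
    rw [Finset.sum_congr rfl fun i _ => by rw [add_comm i 1], ← wordAvg_length_belowWord hC,
      meanDepth, h, sphereAvg]
    have key : ∀ x : Fin 4, (wordAvg (n + q * C) fun u =>
        (depth (mapBelow C (belowWord C 1) (some (x, u))) : ℝ)) =
          (wordAvg (q * C) fun u => ((belowWord C 1 u).length : ℝ)) + C := by
      intro x
      rw [wordAvg_append, ← wordAvg_const n (_ + _)]
      refine wordAvg_congr n fun u hu => ?_
      rw [← wordAvg_const (q * C) (C : ℝ), ← wordAvg_add]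
      refine wordAvg_congr _ fun v _ => ?_
      have hu' : u.length = C - 1 := by omega
      simp only [mapBelow, depth, List.take_left' hu', List.drop_left' hu', List.length_append, hu]
      rw [hn]
      push_cast
      ring
    simp only [key, Finset.sum_const, Finset.card_univ, Fintype.card_fin]
    ring

open Classical in
/-- The number of elements of `bands` below `q`. -/
noncomputable def bandCount (q : ℕ) : ℕ := ((Finset.range q).filter (· ∈ bands)).card

theorem meanDepth_mul_eq {C : ℕ} (hC : 0 < C) (q : ℕ) :
    meanDepth C (q * C) = q * C + bandCount q * (meanX C - C) := by
  classical
  rw [meanDepth_mul hC, Finset.sum_congr rfl fun i _ => meanBlock_eq C i, Finset.sum_add_distrib,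
    ← Finset.sum_filter, Finset.sum_const, Finset.sum_const, Finset.card_range, nsmul_eq_mul,
    nsmul_eq_mul, bandCount]

theorem le_bandCount (n : ℕ) : 7 * 8 ^ (2 * n) ≤ bandCount (8 ^ (2 * n + 1)) := by
  classical
  have h : Finset.Ico (8 ^ (2 * n)) (8 ^ (2 * n + 1)) ⊆
      (Finset.range (8 ^ (2 * n + 1))).filter (· ∈ bands) := by
    intro q hq
    rw [Finset.mem_Ico] at hq
    exact Finset.mem_filter.2 ⟨Finset.mem_range.2 hq.2, n, hq⟩
  have := Finset.card_le_card h
  rw [Nat.card_Ico] at this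
  have := pow_succ 8 (2 * n)
  unfold bandCount
  omega

theorem bandCount_le (n : ℕ) : bandCount (8 ^ (2 * n + 2)) ≤ 8 ^ (2 * n + 1) := by
  classical
  have h : (Finset.range (8 ^ (2 * n + 2))).filter (· ∈ bands) ⊆
      Finset.range (8 ^ (2 * n + 1)) := by
    intro q hq
    obtain ⟨h1, k, h2, h3⟩ := Finset.mem_filter.1 hq
    rw [Finset.mem_range] at h1 ⊢
    have h4 : 2 * k < 2 * n + 2 := (Nat.pow_lt_pow_iff_right (by norm_num)).1 (h2.trans_lt h1)
    exact h3.trans_le (Nat.pow_le_pow_right (by norm_num) (by omega))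
  have := Finset.card_le_card h
  rw [Finset.card_range] at this
  exact this

/-! ### Expectations along a Markov chain -/

/-- The Markov operator of the transition probabilities `P`. -/
noncomputable def markovOp {α : Type} (P : α → PMF α) (G : α → ℝ≥0∞) (x : α) : ℝ≥0∞ :=
  ∑' y, P x y * G y

theorem tsum_bind_mul {α β : Type} (p : PMF α) (k : α → PMF β) (G : β → ℝ≥0∞) :
    ∑' y, p.bind k y * G y = ∑' x, p x * ∑' y, k x y * G y := by
  simp only [PMF.bind_apply, ← ENNReal.tsum_mul_right, ← ENNReal.tsum_mul_left]
  rw [ENNReal.tsum_comm]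
  simp only [mul_assoc]

theorem tsum_pure_mul {α : Type} (x : α) (G : α → ℝ≥0∞) :
    ∑' y, PMF.pure x y * G y = G x := by
  rw [tsum_eq_single x]
  · simp
  · intro y hy
    simp [PMF.pure_apply_of_ne _ _ hy]

theorem tsum_map_mul {α β : Type} (p : PMF α) (f : α → β) (G : β → ℝ≥0∞) :
    ∑' y, p.map f y * G y = ∑' x, p x * G (f x) := by
  rw [← PMF.bind_pure_comp, tsum_bind_mul]
  simp only [Function.comp_apply, tsum_pure_mul]

theorem tsum_stepLaw_mul {α : Type} (P : α → PMF α) (n : ℕ) (x : α) (G : α → ℝ≥0∞) :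
    ∑' y, stepLaw P n x y * G y = (markovOp P)^[n] G x := by
  induction n generalizing G with
  | zero => exact tsum_pure_mul x G
  | succ n ih =>
    rw [stepLaw, tsum_bind_mul, Function.iterate_succ_apply, ← ih]
    rfl

theorem iterate_markovOp_pushforward {α β : Type} (P : α → PMF α) (f : α ≃ β) (n : ℕ)
    (G : β → ℝ≥0∞) (x : α) :
    (markovOp (pushforward P f))^[n] G (f x) = (markovOp P)^[n] (G ∘ f) x := by
  induction n generalizing G with
  | zero => rfl
  | succ n ih =>
    rw [Function.iterate_succ_apply, Function.iterate_succ_apply, ih]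
    refine congrFun (congrArg (markovOp P)^[n] (funext fun y => ?_)) x
    simp only [markovOp, pushforward, Function.comp_apply, Equiv.symm_apply_apply, tsum_map_mul]

theorem markovOp_simpleRandomWalk (G : F2 → ℝ≥0∞) (g : F2) :
    markovOp simpleRandomWalk G g =
      4⁻¹ * ∑ s : Fin 2 × Bool, G (g * FreeGroup.mk [s]) := by
  rw [markovOp, simpleRandomWalk, tsum_map_mul, tsum_fintype, Finset.mul_sum]
  refine Finset.sum_congr rfl fun s _ => ?_
  rw [PMF.uniformOfFintype_apply, Fintype.card_prod, Fintype.card_fin, Fintype.card_bool]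
  norm_num

theorem vertexOp_nonneg {G : Vertex → ℝ} (hG : ∀ v, 0 ≤ G v) (v : Vertex) : 0 ≤ vertexOp G v :=
  div_nonneg (Finset.sum_nonneg fun _ _ => hG _) (by norm_num)

theorem iterate_markovOp_simpleRandomWalk (Λ : Labelling) (n : ℕ) {G : Vertex → ℝ}
    (hG : ∀ v, 0 ≤ G v) (v : Vertex) :
    (markovOp simpleRandomWalk)^[n] (fun g => ENNReal.ofReal (G (Λ.toEquiv.symm g)))
      (Λ.toEquiv v) = ENNReal.ofReal (vertexOp^[n] G v) := by
  induction n generalizing G with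
  | zero => simp
  | succ n ih =>
    rw [Function.iterate_succ_apply, Function.iterate_succ_apply, ← ih (vertexOp_nonneg hG)]
    refine congrFun (congrArg (markovOp simpleRandomWalk)^[n] (funext fun g => ?_)) _
    obtain ⟨w, rfl⟩ := Λ.toEquiv.surjective g
    obtain ⟨σ, hσ⟩ := Λ.exists_equiv_neighbour w
    rw [markovOp_simpleRandomWalk, ← σ.sum_comp]
    simp only [hσ, Equiv.symm_apply_apply, vertexOp]
    rw [ENNReal.ofReal_div_of_pos (by norm_num), ENNReal.ofReal_sum_of_nonneg fun _ _ => hG _,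
      div_eq_mul_inv, mul_comm]
    norm_num

theorem expectedDist_christmasTree (Λ : Labelling) (C : ℕ) (hC : 2 ≤ C) (n : ℕ) :
    expectedDist (pushforward simpleRandomWalk (christmasTreeEquiv Λ C hC)) 1 n =
      ENNReal.ofReal (radialOp^[n] (meanDepth C) 0) := by
  have h := iterate_vertexOp_none n fun v => (depth (mapBelow C (belowWord C 1) v) : ℝ)
  change _ = radialOp^[n] (meanDepth C) 0 at h
  have h1 := christmasTreeEquiv_one Λ C hC
  rw [expectedDist, tsum_stepLaw_mul, ← h,
    ← iterate_markovOp_simpleRandomWalk Λ n (fun _ => Nat.cast_nonneg _), Λ.map_root]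
  conv => lhs; rw [← h1]
  rw [iterate_markovOp_pushforward]
  refine congrFun (congrArg (markovOp simpleRandomWalk)^[n] (funext fun g => ?_)) _
  obtain ⟨v, rfl⟩ := Λ.toEquiv.surjective g
  rw [Function.comp_apply, christmasTreeEquiv_apply, h1, Λ.wordDist_one,
    Equiv.symm_apply_apply, ENNReal.ofReal_natCast]

/-! ### The absence of a drift -/

theorem not_tendsto_of_frequently {x : ℕ → ℝ≥0∞} {α β : ℝ≥0∞} (hαβ : β < α)
    (hα : ∃ᶠ n in atTop, α ≤ x n) (hβ : ∃ᶠ n in atTop, x n ≤ β) (L : ℝ≥0∞) :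
    ¬ Tendsto x atTop (𝓝 L) := by
  intro h
  rcases lt_or_ge L α with hL | hL
  · exact hα ((h.eventually_lt_const hL).mono fun _ => not_le_of_gt)
  · exact hβ ((h.eventually_const_lt (hαβ.trans_le hL)).mono fun _ => not_le_of_gt)

/-- At time `2 * q * C` the mean distance is close to that at distance `q * C` along the tree. -/
theorem abs_iterate_radialOp_meanDepth_div_sub_le {C q : ℕ} (hC : 2 ≤ C) (hq : 0 < q) :
    |radialOp^[2 * (q * C)] (meanDepth C) 0 / (2 * (q * C) : ℕ) -
      (1 / 2 + (meanX C - C) / (2 * C) * (bandCount q / q))| ≤ C / √(2 * (q * C) : ℕ) := by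
  have hM : 0 < q * C := by positivity
  have h := abs_iterate_radialOp_sub_le_sqrt (K := C) (by positivity) hM
    fun m => abs_meanDepth_sub_le hC m (q * C)
  have hn : (0 : ℝ) < (2 * (q * C) : ℕ) := by positivity
  have hC' : (0 : ℝ) < C := by positivity
  have hq' : (0 : ℝ) < q := by positivity
  have h2 : 1 / 2 + (meanX C - C) / (2 * C) * (bandCount q / q) =
      meanDepth C (q * C) / (2 * (q * C) : ℕ) := by
    rw [meanDepth_mul_eq (by omega)]
    push_cast
    field_simp
  rw [h2, ← sub_div, abs_div, abs_of_pos hn, div_le_iff₀ hn]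
  refine h.trans (le_of_eq ?_)
  rw [div_mul_eq_mul_div, mul_div_assoc, Real.div_sqrt]

theorem not_hasDrift (Λ : Labelling) (C : ℕ) (hC : 3 ≤ C) (L : ℝ≥0∞) :
    ¬ HasDrift (pushforward simpleRandomWalk (christmasTreeEquiv Λ C (by omega))) 1 L := by
  set θ := (meanX C - C) / (2 * C)
  have hθ : 0 < θ := div_pos (sub_pos.2 (lt_meanX hC)) (by positivity)
  -- the error term is eventually less than `θ / 8`
  have herr : ∀ᶠ n : ℕ in atTop, C / √(n : ℝ) < θ / 8 := by
    have : Tendsto (fun n : ℕ => C / √(n : ℝ)) atTop (𝓝 0) :=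
      (Real.tendsto_sqrt_atTop.comp tendsto_natCast_atTop_atTop).const_div_atTop _
    exact this.eventually_lt_const (by positivity)
  obtain ⟨N, hN⟩ := eventually_atTop.1 herr
  have hlarge : ∀ m k : ℕ, m ≤ k → m ≤ 2 * (8 ^ k * C) := by
    intro m k hk
    have h1 : k < 8 ^ k := Nat.lt_pow_self (by norm_num)
    have h2 : 8 ^ k ≤ 8 ^ k * C := Nat.le_mul_of_pos_right _ (by omega)
    omega
  have hclose : ∀ k, N ≤ k →
      |radialOp^[2 * (8 ^ k * C)] (meanDepth C) 0 / (2 * (8 ^ k * C) : ℕ) -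
        (1 / 2 + θ * (bandCount (8 ^ k) / 8 ^ k))| < θ / 8 := by
    intro k hk
    have h := abs_iterate_radialOp_meanDepth_div_sub_le (C := C) (q := 8 ^ k) (by omega)
      (by positivity)
    push_cast at h ⊢
    have h' := hN _ (hlarge N k hk)
    push_cast at h'
    exact h.trans_lt h'
  have hE : ∀ k, expectedDist (pushforward simpleRandomWalk (christmasTreeEquiv Λ C (by omega))) 1
      (2 * (8 ^ k * C)) / (2 * (8 ^ k * C) : ℕ) =
        ENNReal.ofReal (radialOp^[2 * (8 ^ k * C)] (meanDepth C) 0 / (2 * (8 ^ k * C) : ℕ)) := by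
    intro k
    rw [expectedDist_christmasTree, ENNReal.ofReal_div_of_pos, ENNReal.ofReal_natCast]
    have : 0 < C := by omega
    positivity
  refine not_tendsto_of_frequently (α := ENNReal.ofReal (1 / 2 + θ * (6 / 8)))
    (β := ENNReal.ofReal (1 / 2 + θ * (2 / 8))) ?_ ?_ ?_ L
  · rw [ENNReal.ofReal_lt_ofReal_iff (by positivity)]
    linarith
  · refine frequently_atTop.2 fun m => ⟨2 * (8 ^ (2 * (m + N) + 1) * C), hlarge _ _ (by omega), ?_⟩
    rw [hE]
    apply ENNReal.ofReal_le_ofReal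
    have h1 := abs_lt.1 (hclose (2 * (m + N) + 1) (by omega))
    have h2 : (7 / 8 : ℝ) ≤ bandCount (8 ^ (2 * (m + N) + 1)) / 8 ^ (2 * (m + N) + 1) := by
      rw [div_le_div_iff₀ (by norm_num) (by positivity)]
      have : (7 * 8 ^ (2 * (m + N)) : ℝ) ≤ bandCount (8 ^ (2 * (m + N) + 1)) := by
        exact_mod_cast le_bandCount (m + N)
      have := pow_succ (8 : ℝ) (2 * (m + N))
      linarith
    have h3 := mul_le_mul_of_nonneg_left h2 hθ.le
    linarith
  · refine frequently_atTop.2 fun m => ⟨2 * (8 ^ (2 * (m + N) + 2) * C), hlarge _ _ (by omega), ?_⟩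
    rw [hE]
    apply ENNReal.ofReal_le_ofReal
    have h1 := abs_lt.1 (hclose (2 * (m + N) + 2) (by omega))
    have h2 : bandCount (8 ^ (2 * (m + N) + 2)) / 8 ^ (2 * (m + N) + 2) ≤ (1 / 8 : ℝ) := by
      rw [div_le_div_iff₀ (by positivity) (by norm_num)]
      have : (bandCount (8 ^ (2 * (m + N) + 2)) : ℝ) ≤ 8 ^ (2 * (m + N) + 1) := by
        exact_mod_cast bandCount_le (m + N)
      have := pow_succ (8 : ℝ) (2 * (m + N) + 1)
      linarith
    have h3 := mul_le_mul_of_nonneg_left h2 hθ.le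
    linarith

end ChristmasTree

theorem theoremB (Λ : Labelling) (C : ℕ) (hC : 4 ≤ C) :
    ∃ f : F2 ≃ F2, (∀ g : F2, f g = christmasTree Λ C g) ∧
      IsQuasiIsometry C 0 f ∧
      f 1 = 1 ∧
      ∀ L : ℝ≥0∞, ¬ HasDrift (pushforward simpleRandomWalk f) (f 1) L := by
  have hC2 : 2 ≤ C := by omega
  refine ⟨christmasTreeEquiv Λ C hC2, christmasTreeEquiv_eq Λ C hC2,
    isQuasiIsometry_christmasTreeEquiv Λ C hC2, christmasTreeEquiv_one Λ C hC2, fun L => ?_⟩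
  rw [christmasTreeEquiv_one]
  exact not_hasDrift Λ C (by omega) L
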